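/- Conventions. A dcpo is a poset in which every nonempty directed subset has a supremum; $\Sigma L$ is a dcpo $L$ with its Scott topology. For a topological space $X$, $x\sqsubseteq y$ iff $x\in\overline{\{y\}}$; order notions in $X$ (directed sets, $\downarrow$, $\uparrow$) refer to $\sqsubseteq$. A directed set $D\subseteq X$ converges to $x$ ($D\to x$) if $D$ meets every open neighbourhood of $x$. A directed space is a $T_0$ space $X$ in which a set $U$ is open as soon as $D\to x\in U$ implies $D\cap U\neq\emptyset$ for all directed $D$ and all $x$. A directed semilattice is a directed space with a commutative, associative, idempotent, separately continuous binary operation; a dcpo semilattice is a dcpo with a commutative, associative, idempotent, Scott-continuous binary operation. Homomorphisms are the continuous (resp. Scott-continuous) maps commuting with the operations. The directed convex powerspace of a directed space $X$ is the free directed semilattice over $X$, and the convex (Plotkin) powerdomain of a dcpo $L$ is the free dcpo semilattice over $L$ (free with respect to continuous, resp. Scott-continuous, maps out of $X$, resp. $L$). The space $\mathcal PX$. For a nonempty finite $F\subseteq X$ put $\widehat F=(\downarrow F,\uparrow F)$, and let $PX$ be the set of all $\widehat F$, ordered by $\widehat F\le_C\widehat G$ iff $\downarrow F\subseteq\downarrow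 G$ and $\uparrow G\subseteq\uparrow F$. For a directed $\mathcal D\subseteq PX$ and $F=\{a_1,\dots,a_n\}$ (repetitions allowed) write $\mathcal D\Rightarrow_C\widehat F$ if there are directed sets $D_1,\dots,D_n\subseteq X$ with $D_i\subseteq\bigcup_{\widehat G\in\mathcal D}\downarrow G$ and $D_i\to a_i$ for all $i$, such that for all $(d_1,\dots,d_n)\in\prod_i D_i$ there is $\widehat G\in\mathcal D$ with $\uparrow G\subseteq\uparrow\{d_1,\dots,d_n\}$. (The relation holds for an element of $PX$ if it holds for some such enumerated $F$ representing it.) A set $\mathcal U\subseteq PX$ is open in $\mathcal PX$ iff $\mathcal D\Rightarrow_C\widehat F\in\mathcal U$ implies $\mathcal D\cap\mathcal U\ne\emptyset$, for all directed $\mathcal D$ and all $\widehat F$. Put $\widehat F+\widehat G=\widehat{F\cup G}$. The D-completion. For a $T_0$ space $Y$, let $\Gamma(Y)$ be the set of nonempty closed subsets of $Y$ ordered by inclusion, and let $\widetilde Y\subseteq\Gamma(Y)$ be the smallest subset that contains all $\downarrow y=\overline{\{y\}}$, $y\in Y$, and is closed under all suprema in $\Gamma(Y)$ of nonempty directed subsets;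 put $\eta(y)=\downarrow y$. A separately continuous operation $+$ on $Y$ extends to $\widetilde Y$ by $A+^dB=\overline{\{a+b:a\in A,\ b\in B\}}$. Statement. Let $L$ be a dcpo and let $\mathcal PL=\mathcal P(\Sigma L)$. Then: (1) $(\mathcal PL,+)$ with the map $x\mapsto\widehat{\{x\}}$ is the directed convex powerspace of $\Sigma L$. (2) $(\widetilde{\mathcal PL},+^d)$ with the map $x\mapsto\eta(\widehat{\{x\}})$ is the free dcpo semilattice over $L$, i.e. the convex powerdomain of $L$. (3) Consequently, for every convex powerdomain $(Q,m)$ of $L$ with unit $j:L\to Q$, there is an order isomorphism $e:\widetilde{\mathcal PL}\to Q$ with $e(A+^dB)=m(e(A),e(B))$ for all $A,B$ and $e(\eta(\widehat{\{x\}}))=j(x)$ for all $x\in L$. -/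

import Mathlib

universe u v w

namespace ConvexPowerdomain

/-! ### Order-theoretic and topological preliminaries -/

/-- A poset is a dcpo if every directed (nonempty) subset has a supremum. -/
def IsDcpo (P : Type u) [PartialOrder P] : Prop :=
  ∀ d : Set P, d.Nonempty → DirectedOn (· ≤ ·) d → ∃ a, IsLUB d a

/-- The specialization order `x ⊑ y` of a topological space. -/
def SpecLE {X : Type u} [TopologicalSpace X] (x y : X) : Prop := x ∈ closure {y}

/-- The lower set `↓F` generated by `F` in the specialization order. -/
def lowerSpan {X : Type u} [TopologicalSpace X] (F : Set X) : Set X :=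
  {x | ∃ a ∈ F, SpecLE x a}

/-- The upper set `↑F` generated by `F` in the specialization order. -/
def upperSpan {X : Type u} [TopologicalSpace X] (F : Set X) : Set X :=
  {x | ∃ a ∈ F, SpecLE a x}

/-- Directed subsets of a topological space, in the specialization order. -/
def SpecDirected {X : Type u} [TopologicalSpace X] (D : Set X) : Prop :=
  D.Nonempty ∧ DirectedOn SpecLE D

/-- Convergence `D → x` of a directed subset `D` to a point `x`. -/
def DirConverges {X : Type u} [TopologicalSpace X] (D : Set X) (x : X) : Prop :=
  ∀ U : Set X, IsOpen U → x ∈ U → (D ∩ U).Nonempty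

/-- Directed spaces: `T₀` spaces in which every directed-open set is open. -/
def IsDirectedSpace (X : Type u) [TopologicalSpace X] : Prop :=
  T0Space X ∧ ∀ U : Set X,
    (∀ (D : Set X) (x : X), SpecDirected D → DirConverges D x → x ∈ U → (D ∩ U).Nonempty) →
      IsOpen U

/-- Separate continuity of a binary operation. -/
def SepContinuous {X : Type u} [TopologicalSpace X] (m : X → X → X) : Prop :=
  (∀ b, Continuous fun a => m a b) ∧ ∀ a, Continuous fun b => m a b

/-- Commutative, associative and idempotent operations. -/
structure IsSemilatticeOp {A : Type u} (m : A → A → A) : Prop where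
  comm : ∀ x y, m x y = m y x
  assoc : ∀ x y z, m (m x y) z = m x (m y z)
  idem : ∀ x, m x x = x

/-! ### Directed semilattices, dcpo semilattices, and the free ones -/

/-- Directed semilattices. -/
structure IsDirectedSemilattice (A : Type u) [TopologicalSpace A] (m : A → A → A) : Prop
    extends IsSemilatticeOp m where
  directedSpace : IsDirectedSpace A
  sepContinuous : SepContinuous m

/-- Dcpo semilattices. -/
structure IsDcpoSemilattice (A : Type u) [PartialOrder A] (m : A → A → A) : Prop
    extends IsSemilatticeOp m where
  dcpo : IsDcpo A
  scottContinuous : ScottContinuous fun p : A × A => m p.1 p.2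

/-- `(A, m)` with the map `i : X → A` is the directed convex powerspace of `X`, i.e. the free
directed semilattice over `X`. -/
structure IsDirectedConvexPowerspace (X : Type u) [TopologicalSpace X]
    (A : Type v) [TopologicalSpace A] (m : A → A → A) (i : X → A) : Prop where
  semilattice : IsDirectedSemilattice A m
  continuous : Continuous i
  universal : ∀ (B : Type w) [TopologicalSpace B] (mB : B → B → B),
    IsDirectedSemilattice B mB → ∀ f : X → B, Continuous f →
      ∃! g : A → B, Continuous g ∧ (∀ a b, g (m a b) = mB (g a) (g b)) ∧ ∀ x, g (i x) = f x

/-- `(A, m)` with the map `i : L → A` is the convex (Plotkin) powerdomain of `L`, i.e. the free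
dcpo semilattice over `L`. -/
structure IsConvexPowerdomain (L : Type u) [PartialOrder L]
    (A : Type v) [PartialOrder A] (m : A → A → A) (i : L → A) : Prop where
  semilattice : IsDcpoSemilattice A m
  scottContinuous : ScottContinuous i
  universal : ∀ (B : Type w) [PartialOrder B] (mB : B → B → B),
    IsDcpoSemilattice B mB → ∀ f : L → B, ScottContinuous f →
      ∃! g : A → B, ScottContinuous g ∧ (∀ a b, g (m a b) = mB (g a) (g b)) ∧ ∀ x, g (i x) = f x

/-! ### The space `𝒫X` -/

/-- The set of all pairs `(↓F, ↑F)`, `F` a nonempty finite subset of `X`. -/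
def Pow (X : Type u) [TopologicalSpace X] : Type u :=
  {p : Set X × Set X // ∃ F : Set X, F.Finite ∧ F.Nonempty ∧ p = (lowerSpan F, upperSpan F)}

/-- `F̂ = (↓F, ↑F)`. -/
def hat {X : Type u} [TopologicalSpace X] (F : Set X) (hF : F.Finite) (hne : F.Nonempty) : Pow X :=
  ⟨(lowerSpan F, upperSpan F), F, hF, hne, rfl⟩

/-- The map `x ↦ {x}^`. -/
def unit {X : Type u} [TopologicalSpace X] (x : X) : Pow X :=
  hat {x} (Set.finite_singleton x) (Set.singleton_nonempty x)

/-- The first component `↓F` of `(↓F, ↑F)`. -/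
def Pow.lower {X : Type u} [TopologicalSpace X] (P : Pow X) : Set X := P.1.1

/-- The second component `↑F` of `(↓F, ↑F)`. -/
def Pow.upper {X : Type u} [TopologicalSpace X] (P : Pow X) : Set X := P.1.2

/-- The order `≤_C`. -/
instance {X : Type u} [TopologicalSpace X] : PartialOrder (Pow X) where
  le P Q := P.lower ⊆ Q.lower ∧ Q.upper ⊆ P.upper
  le_refl _ := ⟨subset_rfl, subset_rfl⟩
  le_trans _ _ _ h k := ⟨h.1.trans k.1, k.2.trans h.2⟩
  le_antisymm _ _ h k :=
    Subtype.ext (Prod.ext (h.1.antisymm k.1) (k.2.antisymm h.2))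

/-- The convergence relation `𝒟 ⇒_C F̂`, where `F = {a₁, …, aₙ}`. -/
def ConvC {X : Type u} [TopologicalSpace X] (𝒟 : Set (Pow X)) (P : Pow X) : Prop :=
  ∃ (n : ℕ) (a : Fin n → X) (D : Fin n → Set X),
    P.1 = (lowerSpan (Set.range a), upperSpan (Set.range a)) ∧
    (∀ i, SpecDirected (D i)) ∧
    (∀ i, D i ⊆ ⋃ Q ∈ 𝒟, Q.lower) ∧
    (∀ i, DirConverges (D i) (a i)) ∧
    ∀ d : Fin n → X, (∀ i, d i ∈ D i) → ∃ Q ∈ 𝒟, Q.upper ⊆ upperSpan (Set.range d)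

/-- The `⇒_C` convergence open subsets. -/
def IsConvOpen {X : Type u} [TopologicalSpace X] (U : Set (Pow X)) : Prop :=
  ∀ (𝒟 : Set (Pow X)) (P : Pow X), 𝒟.Nonempty → DirectedOn (· ≤ ·) 𝒟 → ConvC 𝒟 P → P ∈ U →
    (𝒟 ∩ U).Nonempty

theorem SpecLE.refl {X : Type u} [TopologicalSpace X] (x : X) : SpecLE x x :=
  subset_closure rfl

theorem SpecLE.trans {X : Type u} [TopologicalSpace X] {x y z : X} (h : SpecLE x y)
    (k : SpecLE y z) : SpecLE x z :=
  closure_minimal (Set.singleton_subset_iff.2 k) isClosed_closure h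

theorem specDirected_singleton {X : Type u} [TopologicalSpace X] (x : X) :
    SpecDirected ({x} : Set X) :=
  ⟨⟨x, rfl⟩, by rintro _ rfl _ rfl; exact ⟨_, rfl, SpecLE.refl _, SpecLE.refl _⟩⟩

theorem dirConverges_singleton {X : Type u} [TopologicalSpace X] (x : X) :
    DirConverges ({x} : Set X) x :=
  fun _ _ hx => ⟨x, rfl, hx⟩

theorem subset_lowerSpan {X : Type u} [TopologicalSpace X] (F : Set X) : F ⊆ lowerSpan F :=
  fun x hx => ⟨x, hx, SpecLE.refl x⟩

theorem lowerSpan_union {X : Type u} [TopologicalSpace X] (F G : Set X) :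
    lowerSpan (F ∪ G) = lowerSpan F ∪ lowerSpan G := by
  ext x
  simp only [lowerSpan, Set.mem_ofPred_eq, Set.mem_union]
  constructor
  · rintro ⟨a, ha | ha, h⟩
    exacts [Or.inl ⟨a, ha, h⟩, Or.inr ⟨a, ha, h⟩]
  · rintro (⟨a, ha, h⟩ | ⟨a, ha, h⟩)
    exacts [⟨a, Or.inl ha, h⟩, ⟨a, Or.inr ha, h⟩]

theorem upperSpan_union {X : Type u} [TopologicalSpace X] (F G : Set X) :
    upperSpan (F ∪ G) = upperSpan F ∪ upperSpan G := by
  ext x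
  simp only [upperSpan, Set.mem_ofPred_eq, Set.mem_union]
  constructor
  · rintro ⟨a, ha | ha, h⟩
    exacts [Or.inl ⟨a, ha, h⟩, Or.inr ⟨a, ha, h⟩]
  · rintro (⟨a, ha, h⟩ | ⟨a, ha, h⟩)
    exacts [⟨a, Or.inl ha, h⟩, ⟨a, Or.inr ha, h⟩]

/-- Every element of `Pow X` comes from a finite enumeration. -/
theorem Pow.exists_enum {X : Type u} [TopologicalSpace X] (P : Pow X) :
    ∃ (n : ℕ) (a : Fin n → X),
      P.1 = (lowerSpan (Set.range a), upperSpan (Set.range a)) := by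
  obtain ⟨p, F, hF, -, rfl⟩ := P
  obtain ⟨n, a, -, ha⟩ := hF.fin_param
  exact ⟨n, a, by rw [ha]⟩

theorem convC_singleton {X : Type u} [TopologicalSpace X] {P Q : Pow X} (h : P ≤ Q) :
    ConvC {Q} P := by
  obtain ⟨n, a, ha⟩ := P.exists_enum
  have hl : P.lower = lowerSpan (Set.range a) := congrArg Prod.fst ha
  have hu : P.upper = upperSpan (Set.range a) := congrArg Prod.snd ha
  refine ⟨n, a, fun i => {a i}, ha, fun i => specDirected_singleton _, fun i => ?_,
    fun i => dirConverges_singleton _, fun d hd => ⟨Q, rfl, ?_⟩⟩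
  · rintro _ rfl
    refine Set.mem_biUnion (Set.mem_singleton Q) (h.1 ?_)
    rw [hl]
    exact subset_lowerSpan _ ⟨i, rfl⟩
  · obtain rfl : d = a := funext hd
    exact h.2.trans hu.subset

theorem IsConvOpen.isUpperSet {X : Type u} [TopologicalSpace X] {U : Set (Pow X)}
    (hU : IsConvOpen U) : IsUpperSet U := by
  intro P Q h hP
  obtain ⟨R, rfl, hR⟩ := hU {Q} P ⟨Q, rfl⟩
    (by rintro _ rfl _ rfl; exact ⟨_, rfl, le_rfl, le_rfl⟩) (convC_singleton h) hP
  exact hR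

/-- The topology `O_{⇒_C}`. -/
instance {X : Type u} [TopologicalSpace X] : TopologicalSpace (Pow X) where
  IsOpen := IsConvOpen
  isOpen_univ := fun 𝒟 _ hne _ _ _ => by simpa using hne
  isOpen_inter := by
    intro U V hU hV 𝒟 P hne hd hc hP
    obtain ⟨Q, hQ, hQU⟩ := hU 𝒟 P hne hd hc hP.1
    obtain ⟨R, hR, hRV⟩ := hV 𝒟 P hne hd hc hP.2
    obtain ⟨S, hS, h1, h2⟩ := hd Q hQ R hR
    exact ⟨S, hS, hU.isUpperSet h1 hQU, hV.isUpperSet h2 hRV⟩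
  isOpen_sUnion := by
    rintro s hs 𝒟 P hne hd hc ⟨U, hU, hP⟩
    obtain ⟨Q, hQ, hQU⟩ := hs U hU 𝒟 P hne hd hc hP
    exact ⟨Q, hQ, U, hU, hQU⟩

/-- The operation `F̂ + Ĝ = (F ∪ G)^`, see `hat_add_hat`. -/
instance {X : Type u} [TopologicalSpace X] : Add (Pow X) where
  add P Q := ⟨(P.lower ∪ Q.lower, P.upper ∪ Q.upper), by
    obtain ⟨_, F, hF, hF', rfl⟩ := P
    obtain ⟨_, G, hG, -, rfl⟩ := Q
    exact ⟨F ∪ G, hF.union hG, hF'.inl, by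
      rw [lowerSpan_union, upperSpan_union]; rfl⟩⟩

theorem hat_add_hat {X : Type u} [TopologicalSpace X] {F G : Set X} (hF : F.Finite)
    (hF' : F.Nonempty) (hG : G.Finite) (hG' : G.Nonempty) :
    hat F hF hF' + hat G hG hG' = hat (F ∪ G) (hF.union hG) hF'.inl :=
  Subtype.ext (Prod.ext (lowerSpan_union F G).symm (upperSpan_union F G).symm)

theorem Pow.add_comm' {X : Type u} [TopologicalSpace X] (P Q : Pow X) : P + Q = Q + P :=
  Subtype.ext (Prod.ext (Set.union_comm _ _) (Set.union_comm _ _))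

theorem ConvC.add {X : Type u} [TopologicalSpace X] {𝒟 : Set (Pow X)} {P : Pow X}
    (h : ConvC 𝒟 P) (hne : 𝒟.Nonempty) (Q : Pow X) : ConvC ((· + Q) '' 𝒟) (P + Q) := by
  obtain ⟨n, a, D, hP, hD, hDl, hDc, hDu⟩ := h
  obtain ⟨k, b, hQ⟩ := Q.exists_enum
  have hPl : P.lower = lowerSpan (Set.range a) := congrArg Prod.fst hP
  have hPu : P.upper = upperSpan (Set.range a) := congrArg Prod.snd hP
  have hQl : Q.lower = lowerSpan (Set.range b) := congrArg Prod.fst hQ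
  have hQu : Q.upper = upperSpan (Set.range b) := congrArg Prod.snd hQ
  refine ⟨n + k, Fin.append a b, Fin.append D (fun j => {b j}), ?_, ?_, ?_, ?_, ?_⟩
  · have hr : Set.range (Fin.append a b) = Set.range a ∪ Set.range b := by
      ext x
      constructor
      · rintro ⟨i, rfl⟩
        induction i using Fin.addCases with
        | left i => simp
        | right j => simp
      · rintro (⟨i, rfl⟩ | ⟨j, rfl⟩)
        exacts [⟨Fin.castAdd k i, by simp⟩, ⟨Fin.natAdd n j, by simp⟩]
    rw [hr, lowerSpan_union, upperSpan_union, ← hPl, ← hPu, ← hQl, ← hQu]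
    rfl
  · intro i
    induction i using Fin.addCases with
    | left i => simpa using hD i
    | right j => simpa using specDirected_singleton (b j)
  · intro i x hx
    simp only [Set.mem_iUnion, exists_prop, Set.exists_mem_image]
    induction i using Fin.addCases with
    | left i =>
      obtain ⟨R, hR, hxR⟩ := Set.mem_iUnion₂.1 (hDl i (by simpa using hx))
      exact ⟨R, hR, Or.inl hxR⟩
    | right j =>
      obtain ⟨R, hR⟩ := hne
      obtain rfl : x = b j := by simpa using hx
      refine ⟨R, hR, Or.inr ?_⟩
      rw [hQl]
      exact subset_lowerSpan _ ⟨j, rfl⟩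
  · intro i
    induction i using Fin.addCases with
    | left i => simpa using hDc i
    | right j => simpa using dirConverges_singleton (b j)
  · intro d hd
    obtain ⟨R, hR, hRd⟩ := hDu (fun i => d (Fin.castAdd k i))
      (fun i => by simpa using hd (Fin.castAdd k i))
    refine ⟨R + Q, ⟨R, hR, rfl⟩, ?_⟩
    rintro x (hx | hx)
    · obtain ⟨_, ⟨i, rfl⟩, h⟩ := hRd hx
      exact ⟨_, ⟨Fin.castAdd k i, rfl⟩, h⟩
    · change x ∈ Q.upper at hx
      rw [hQu] at hx
      obtain ⟨_, ⟨j, rfl⟩, h⟩ := hx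
      refine ⟨_, ⟨Fin.natAdd n j, rfl⟩, ?_⟩
      have := hd (Fin.natAdd n j)
      simp only [Fin.append_right, Set.mem_singleton_iff] at this
      rwa [this]

theorem Pow.add_le_add_right' {X : Type u} [TopologicalSpace X] {P R : Pow X} (h : P ≤ R)
    (Q : Pow X) : P + Q ≤ R + Q :=
  ⟨Set.union_subset_union_left _ h.1, Set.union_subset_union_left _ h.2⟩

theorem sepContinuous_add (X : Type u) [TopologicalSpace X] :
    SepContinuous fun P Q : Pow X => P + Q := by
  have key : ∀ Q : Pow X, Continuous fun P : Pow X => P + Q := by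
    intro Q
    refine continuous_def.2 fun U hU 𝒟 P hne hd hc hP => ?_
    obtain ⟨_, ⟨R, hR, rfl⟩, hRU⟩ := (show IsConvOpen U from hU) ((· + Q) '' 𝒟) (P + Q)
      (hne.image _) (by
        rintro _ ⟨R, hR, rfl⟩ _ ⟨S, hS, rfl⟩
        obtain ⟨T, hT, h1, h2⟩ := hd R hR S hS
        exact ⟨_, ⟨T, hT, rfl⟩, Pow.add_le_add_right' h1 Q, Pow.add_le_add_right' h2 Q⟩)
      (hc.add hne Q) hP
    exact ⟨R, hR, hRU⟩
  refine ⟨key, fun P => ?_⟩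
  simp only [Pow.add_comm' P]
  exact key P

/-! ### The D-completion -/

/-- `Γ(X)`: the nonempty closed subsets of `X`, ordered by inclusion. -/
abbrev Gam (X : Type u) [TopologicalSpace X] : Type u :=
  {A : TopologicalSpace.Closeds X // (A : Set X).Nonempty}

/-- The principal ideal `↓x`, the closure of `{x}`, as an element of `Γ(X)`. -/
def princ {X : Type u} [TopologicalSpace X] (x : X) : Gam X :=
  ⟨TopologicalSpace.Closeds.closure {x}, x, subset_closure rfl⟩

/-- The d-closure of a subset of a poset: the least superset that is closed under all existing
suprema of directed subsets. -/
def dClosure {P : Type u} [PartialOrder P] (S : Set P) : Set P :=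
  ⋂₀ {T | S ⊆ T ∧ DirSupClosed T}

/-- The D-completion of `X`: the d-closure of `{↓x : x ∈ X}` in `Γ(X)`, ordered by inclusion. -/
abbrev DCompletion (X : Type u) [TopologicalSpace X] : Type u :=
  {A : Gam X // A ∈ dClosure (Set.range (princ : X → Gam X))}

/-- The canonical map `x ↦ ↓x` into the D-completion. -/
def eta {X : Type u} [TopologicalSpace X] (x : X) : DCompletion X :=
  ⟨princ x, Set.mem_sInter.2 fun _ hT => hT.1 ⟨x, rfl⟩⟩

/-- The operation `(A, B) ↦ cl {m a b : a ∈ A, b ∈ B}` on `Γ(X)`. -/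
def gam {X : Type u} [TopologicalSpace X] (m : X → X → X) (A B : Gam X) : Gam X :=
  ⟨TopologicalSpace.Closeds.closure (Set.image2 m A.1 B.1),
    (A.2.image2 B.2).mono subset_closure⟩

theorem gam_mono_left {X : Type u} [TopologicalSpace X] (m : X → X → X) {A A' : Gam X}
    (h : A ≤ A') (B : Gam X) : gam m A B ≤ gam m A' B :=
  closure_mono (Set.image2_subset h subset_rfl)

theorem subset_closure_of_isLUB {X : Type u} [TopologicalSpace X] {d : Set (Gam X)} {A : Gam X}
    (hne : d.Nonempty) (h : IsLUB d A) :
    (A.1 : Set X) ⊆ closure (⋃ B ∈ d, (B.1 : Set X)) := by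
  obtain ⟨B, hB⟩ := hne
  have hsub : ∀ B ∈ d, (B.1 : Set X) ⊆ closure (⋃ B ∈ d, (B.1 : Set X)) := fun B hB =>
    (Set.subset_biUnion_of_mem (u := fun B : Gam X => (B.1 : Set X)) hB).trans subset_closure
  let E : Gam X := ⟨TopologicalSpace.Closeds.closure (⋃ B ∈ d, (B.1 : Set X)),
    B.2.mono (hsub B hB)⟩
  have hE : E ∈ upperBounds d := fun C hC => hsub C hC
  exact h.2 hE

/-- In its first argument the operation on `Γ(X)` preserves suprema. -/
theorem gam_isLUB {X : Type u} [TopologicalSpace X] {m : X → X → X}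
    (hm : ∀ b, Continuous fun a => m a b) {d : Set (Gam X)} {A : Gam X} (hne : d.Nonempty)
    (h : IsLUB d A) (B : Gam X) : IsLUB ((gam m · B) '' d) (gam m A B) := by
  constructor
  · rintro _ ⟨C, hC, rfl⟩
    exact gam_mono_left m (h.1 hC) B
  · intro C hC
    refine closure_minimal ?_ C.1.isClosed
    rintro _ ⟨a, ha, b, hb, rfl⟩
    have h1 : closure (⋃ D ∈ d, (D.1 : Set X)) ⊆ (fun a => m a b) ⁻¹' (C.1 : Set X) := by
      refine closure_minimal (Set.iUnion₂_subset fun D hD x hx => ?_)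
        (C.1.isClosed.preimage (hm b))
      exact hC ⟨D, hD, rfl⟩ (subset_closure ⟨x, hx, b, hb, rfl⟩)
    exact h1 (subset_closure_of_isLUB hne h ha)

theorem dirSupClosed_gam {X : Type u} [TopologicalSpace X] {m : X → X → X}
    (hm : ∀ b, Continuous fun a => m a b) {T : Set (Gam X)} (hT : DirSupClosed T) (B : Gam X) :
    DirSupClosed {A | gam m A B ∈ T} := by
  intro d hd hne hdir A hA
  refine hT (d := (gam m · B) '' d) (Set.image_subset_iff.2 hd) (hne.image _) ?_
    (gam_isLUB hm hne hA B)
  rintro _ ⟨C, hC, rfl⟩ _ ⟨D, hD, rfl⟩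
  obtain ⟨E, hE, h1, h2⟩ := hdir C hC D hD
  exact ⟨_, ⟨E, hE, rfl⟩, gam_mono_left m h1 B, gam_mono_left m h2 B⟩

theorem gam_swap {X : Type u} [TopologicalSpace X] (m : X → X → X) (A B : Gam X) :
    gam m A B = gam (fun a b => m b a) B A :=
  Subtype.ext (congrArg TopologicalSpace.Closeds.closure (Set.image2_swap m _ _))

theorem gam_princ {X : Type u} [TopologicalSpace X] {m : X → X → X} (hm : SepContinuous m)
    (x y : X) : gam m (princ x) (princ y) = princ (m x y) := by
  apply le_antisymm
  · refine closure_minimal ?_ isClosed_closure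
    rintro _ ⟨a, ha, b, hb, rfl⟩
    have h1 : ∀ a ∈ closure {x}, m a y ∈ closure {m x y} := fun a ha =>
      closure_minimal (t := (fun a => m a y) ⁻¹' closure {m x y})
        (Set.singleton_subset_iff.2 (subset_closure rfl)) (isClosed_closure.preimage (hm.1 y)) ha
    exact closure_minimal (t := (fun b => m a b) ⁻¹' closure {m x y})
        (Set.singleton_subset_iff.2 (h1 a ha)) (isClosed_closure.preimage (hm.2 a)) hb
  · refine closure_mono (Set.singleton_subset_iff.2 ?_)
    exact ⟨x, subset_closure rfl, y, subset_closure rfl, rfl⟩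

theorem gam_mem {X : Type u} [TopologicalSpace X] {m : X → X → X} (hm : SepContinuous m)
    {A B : Gam X} (hA : A ∈ dClosure (Set.range (princ : X → Gam X)))
    (hB : B ∈ dClosure (Set.range (princ : X → Gam X))) :
    gam m A B ∈ dClosure (Set.range (princ : X → Gam X)) := by
  refine Set.mem_sInter.2 fun T hT => ?_
  refine Set.mem_sInter.1 hA {A | gam m A B ∈ T} ⟨?_, dirSupClosed_gam hm.1 hT.2 B⟩
  rintro _ ⟨x, rfl⟩
  rw [Set.mem_ofPred_eq, gam_swap]
  refine Set.mem_sInter.1 hB {B | gam (fun a b => m b a) B (princ x) ∈ T}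
    ⟨?_, dirSupClosed_gam hm.2 hT.2 _⟩
  rintro _ ⟨y, rfl⟩
  rw [Set.mem_ofPred_eq, ← gam_swap, gam_princ hm]
  exact hT.1 ⟨_, rfl⟩

/-- The extension `m^d` of a separately continuous operation `m` to the D-completion. -/
def extend {X : Type u} [TopologicalSpace X] (m : X → X → X) (hm : SepContinuous m)
    (A B : DCompletion X) : DCompletion X :=
  ⟨gam m A.1 B.1, gam_mem hm A.2 B.2⟩

/-- The operation `+^d` on the D-completion of `𝒫X`. -/
def plusD {X : Type u} [TopologicalSpace X] :
    DCompletion (Pow X) → DCompletion (Pow X) → DCompletion (Pow X) :=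
  extend (fun P Q => P + Q) (sepContinuous_add X)

/-- The directed convex powerspace `𝒫L` of the Scott space `ΣL`. -/
abbrev ScottPow (L : Type u) [PartialOrder L] : Type u := Pow (Topology.WithScott L)

/-- The map `L → 𝒫L`, `x ↦ {x}^`, followed by the canonical map into the D-completion. -/
def dUnit {L : Type u} [PartialOrder L] (x : L) : DCompletion (ScottPow L) :=
  eta (unit (Topology.WithScott.toScott x))

end ConvexPowerdomain

/-! A homomorphism on `𝒫X` is determined by its values on singletons, because each `F̂` is a finite
sum of these. So a continuous `f : X → B` into a directed semilattice can only extend by `F̂ ↦ ∑_{a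
∈ F} f a`. This is well defined: sums for a commutative idempotent operation are monotone for the
Egli-Milner order (`sum_specLE_sum_of_egliMilner`), and `B` is `T₀`. Continuity
(`Pow.continuous_lift`) follows from the definition of `⇒_C`. A sum of limits lying in an open set
is approximated by a sum over a tuple from the converging directed sets (`exists_sum_mem`), and some
member of `𝒟` dominates this tuple.

The D-completion converts this into a statement about dcpos. A continuous `g` from `Y` into a dcpo
with its Scott topology extends to `Ỹ` by `A ↦ sup g(A)` (`DCompletion.exists_lift`).
Scott-continuous maps on `Ỹ` that agree on `η(Y)` are equal (`DCompletion.hom_ext`), so semilattice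
laws and homomorphism equations pass from `Y` to `Ỹ`. A dcpo semilattice with its Scott topology is
a directed semilattice, hence the two universal properties compose. Part (3) is the uniqueness of
free objects. -/

namespace ConvexPowerdomain

/-! ### Finite sums in a semilattice -/

namespace IsSemilatticeOp

variable {A : Type*} {m : A → A → A} {ι κ : Type*}

/-- The join semilattice whose join is `m`. -/
abbrev semilatticeSup (h : IsSemilatticeOp m) : SemilatticeSup A :=
  @SemilatticeSup.mk' A ⟨m⟩ h.comm h.assoc h.idem

/-- The sum, with respect to `m`, of a nonempty finite family. -/
def sum (h : IsSemilatticeOp m) (s : Finset ι) (hs : s.Nonempty) (f : ι → A) : A :=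
  @Finset.sup' A ι h.semilatticeSup s hs f

theorem sum_cons (h : IsSemilatticeOp m) {s : Finset ι} (hs : s.Nonempty) {i : ι} (hi : i ∉ s)
    (f : ι → A) : h.sum (Finset.cons i s hi) (Finset.cons_nonempty hi) f = m (f i) (h.sum s hs f) :=
  @Finset.sup'_cons A ι h.semilatticeSup s hs f i hi

theorem sum_union [DecidableEq ι] (h : IsSemilatticeOp m) {s t : Finset ι} (hs : s.Nonempty)
    (ht : t.Nonempty) (f : ι → A) :
    h.sum (s ∪ t) hs.inl f = m (h.sum s hs f) (h.sum t ht f) :=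
  @Finset.sup'_union A ι h.semilatticeSup _ s t hs ht f

/-- By idempotence a sum depends only on the set of its summands, so it may be reindexed along any
surjection. This brings two sums over one index set. -/
theorem sum_comp_eq (h : IsSemilatticeOp m) {s : Finset ι} (hs : s.Nonempty) {r : Finset κ}
    (hr : r.Nonempty) {φ : κ → ι} (hφ : ∀ k ∈ r, φ k ∈ s) (hφ' : ∀ i ∈ s, ∃ k ∈ r, φ k = i)
    (f : ι → A) : h.sum r hr (fun k => f (φ k)) = h.sum s hs f := by
  let := h.semilatticeSup
  apply le_antisymm
  · exact Finset.sup'_le _ _ fun k hk => Finset.le_sup' f (hφ k hk)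
  · refine Finset.sup'_le _ _ fun i hi => ?_
    obtain ⟨k, hk, rfl⟩ := hφ' i hi
    exact Finset.le_sup' (fun k => f (φ k)) hk

end IsSemilatticeOp

/-! ### The specialization order, and sums in topological semilattices -/

theorem SpecLE.map {X Y : Type*} [TopologicalSpace X] [TopologicalSpace Y] {f : X → Y}
    (hf : Continuous f) {x y : X} (h : SpecLE x y) : SpecLE (f x) (f y) :=
  specializes_iff_mem_closure.1 ((specializes_iff_mem_closure.2 h).map hf)

theorem SpecLE.mem_open {X : Type*} [TopologicalSpace X] {x y : X} (h : SpecLE x y) {U : Set X}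
    (hU : IsOpen U) (hx : x ∈ U) : y ∈ U :=
  (specializes_iff_mem_closure.2 h).mem_open hU hx

theorem SpecLE.antisymm {X : Type*} [TopologicalSpace X] [T0Space X] {x y : X} (h : SpecLE x y)
    (k : SpecLE y x) : x = y :=
  ((specializes_iff_mem_closure.2 k).antisymm (specializes_iff_mem_closure.2 h)).eq

section Sums

variable {A : Type*} [TopologicalSpace A] {m : A → A → A} {ι κ : Type*}

theorem SepContinuous.specLE (hm : SepContinuous m) {a a' b b' : A} (h : SpecLE a a')
    (k : SpecLE b b') : SpecLE (m a b) (m a' b') :=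
  (h.map (hm.1 b)).trans (k.map (hm.2 a'))

theorem IsSemilatticeOp.sum_specLE_sum (h : IsSemilatticeOp m) (hm : SepContinuous m)
    {s : Finset ι} (hs : s.Nonempty) {f g : ι → A} (hfg : ∀ i ∈ s, SpecLE (f i) (g i)) :
    SpecLE (h.sum s hs f) (h.sum s hs g) := by
  induction hs using Finset.Nonempty.cons_induction with
  | singleton i => exact hfg i (Finset.mem_singleton_self i)
  | cons i s hi hs ih =>
    rw [h.sum_cons hs, h.sum_cons hs]
    exact hm.specLE (hfg i (Finset.mem_cons_self i s))
      (ih fun j hj => hfg j (Finset.mem_cons_of_mem hj))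

/-- Sums are monotone for the Egli-Milner order. -/
theorem IsSemilatticeOp.sum_specLE_sum_of_egliMilner (h : IsSemilatticeOp m)
    (hm : SepContinuous m) {s : Finset ι} (hs : s.Nonempty) {t : Finset κ} (ht : t.Nonempty)
    {f : ι → A} {g : κ → A} (hst : ∀ i ∈ s, ∃ j ∈ t, SpecLE (f i) (g j))
    (hts : ∀ j ∈ t, ∃ i ∈ s, SpecLE (f i) (g j)) :
    SpecLE (h.sum s hs f) (h.sum t ht g) := by
  classical
  -- The Egli-Milner conditions say that both projections of this relation are onto. Both sums thus
  -- become sums over `r`, where they compare termwise.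
  set r : Finset (ι × κ) := (s ×ˢ t).filter fun p => SpecLE (f p.1) (g p.2) with hr
  have mem_r : ∀ i j, (i, j) ∈ r ↔ (i ∈ s ∧ j ∈ t) ∧ SpecLE (f i) (g j) := by simp [hr]
  have hrne : r.Nonempty := by
    obtain ⟨i, hi⟩ := hs
    obtain ⟨j, hj, hij⟩ := hst i hi
    exact ⟨(i, j), (mem_r i j).2 ⟨⟨hi, hj⟩, hij⟩⟩
  rw [← h.sum_comp_eq hs hrne (φ := Prod.fst) (fun p hp => ((mem_r _ _).1 hp).1.1) fun i hi => ?_,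
    ← h.sum_comp_eq ht hrne (φ := Prod.snd) (fun p hp => ((mem_r _ _).1 hp).1.2) fun j hj => ?_]
  · exact h.sum_specLE_sum hm hrne fun p hp => ((mem_r _ _).1 hp).2
  · obtain ⟨i, hi, hij⟩ := hts j hj
    exact ⟨(i, j), (mem_r i j).2 ⟨⟨hi, hj⟩, hij⟩, rfl⟩
  · obtain ⟨j, hj, hij⟩ := hst i hi
    exact ⟨(i, j), (mem_r i j).2 ⟨⟨hi, hj⟩, hij⟩, rfl⟩

/-- A sum is continuous in each single summand. -/
theorem IsSemilatticeOp.continuous_sum_update [DecidableEq ι] (h : IsSemilatticeOp m)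
    (hm : SepContinuous m) {X : Type*} [TopologicalSpace X] {f : X → A} (hf : Continuous f)
    {s : Finset ι} (hs : s.Nonempty) (d : ι → X) (i : ι) :
    Continuous fun x => h.sum s hs fun j => f (Function.update d i x j) := by
  have hupd : ∀ j, Continuous fun x => f (Function.update d i x j) := fun j =>
    by
    refine hf.comp ?_
    by_cases hji : j = i
    · subst hji
      simpa using continuous_id'
    · simpa [Function.update_of_ne hji] using continuous_const
  induction hs using Finset.Nonempty.cons_induction with
  | singleton j => exact hupd j
  | cons j s hj hs ih =>
    simp only [h.sum_cons hs]
    by_cases hij : j = i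
    · subst hij
      -- The updated coordinate is not in `s`, so only the first summand varies and separate
      -- continuity suffices.
      have : ∀ x, (h.sum s hs fun k => f (Function.update d j x k)) =
          h.sum s hs fun k => f (d k) := fun x =>
        @Finset.sup'_congr A ι h.semilatticeSup s hs s _ _ rfl fun k hk => by
          rw [Function.update_of_ne (ne_of_mem_of_not_mem hk hj)]
      simp only [this]
      exact (hm.1 _).comp (hupd j)
    · simp only [Function.update_of_ne hij]
      exact (hm.2 _).comp ih

/-- If sets converge to the points of a finite tuple, then the sums of tuples taken from
these sets converge to the sum of the tuple. -/
theorem IsSemilatticeOp.exists_sum_mem (h : IsSemilatticeOp m) (hm : SepContinuous m)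
    {X : Type*} [TopologicalSpace X] {f : X → A} (hf : Continuous f) [Fintype ι]
    (hne : (Finset.univ : Finset ι).Nonempty) {a : ι → X} {D : ι → Set X}
    (hD : ∀ i, DirConverges (D i) (a i)) {U : Set A} (hU : IsOpen U)
    (ha : h.sum Finset.univ hne (fun i => f (a i)) ∈ U) :
    ∃ d : ι → X, (∀ i, d i ∈ D i) ∧ h.sum Finset.univ hne (fun i => f (d i)) ∈ U := by
  classical
  -- Coordinates are moved from `a` into the `D i` one at a time, as continuity is available only in
  -- each summand separately.
  have key : ∀ s : Finset ι, ∃ d : ι → X, (∀ i ∈ s, d i ∈ D i) ∧ (∀ i ∉ s, d i = a i) ∧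
      h.sum Finset.univ hne (fun i => f (d i)) ∈ U := by
    intro s
    induction s using Finset.induction_on with
    | empty => exact ⟨a, by simp, by simp, ha⟩
    | insert i s hi ih =>
      obtain ⟨d, hds, hda, hd⟩ := ih
      obtain ⟨x, hxD, hx⟩ := hD i _
        (hU.preimage (h.continuous_sum_update hm hf hne d i))
        (by rwa [Set.mem_preimage, ← hda i hi, Function.update_eq_self])
      refine ⟨Function.update d i x, fun j hj => ?_, fun j hj => ?_, hx⟩
      · by_cases hji : j = i
        · subst hji
          rwa [Function.update_self]
        · rw [Function.update_of_ne hji]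
          exact hds j ((Finset.mem_insert.1 hj).resolve_left hji)
      · rw [Finset.mem_insert, not_or] at hj
        rw [Function.update_of_ne hj.1, hda j hj.2]
  obtain ⟨d, hd, -, hdU⟩ := key Finset.univ
  exact ⟨d, fun i => hd i (Finset.mem_univ i), hdU⟩

end Sums

/-! ### The space `𝒫X` is a directed space -/

section Pow

variable {X : Type u} [TopologicalSpace X]

theorem Pow.upper_nonempty (P : Pow X) : P.upper.Nonempty := by
  obtain ⟨_, F, -, ⟨x, hx⟩, rfl⟩ := P
  exact ⟨x, x, hx, SpecLE.refl x⟩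

theorem Pow.exists_finset (P : Pow X) : ∃ s : Finset X, s.Nonempty ∧
    P.lower = lowerSpan (s : Set X) ∧ P.upper = upperSpan (s : Set X) := by
  obtain ⟨_, F, hF, hne, rfl⟩ := P
  lift F to Finset X using hF
  exact ⟨F, hne, rfl, rfl⟩

theorem unit_le_unit {x y : X} (h : SpecLE x y) : unit x ≤ unit y := by
  constructor
  · rintro z ⟨_, rfl, hz⟩
    exact ⟨y, rfl, hz.trans h⟩
  · rintro z ⟨_, rfl, hz⟩
    exact ⟨x, rfl, h.trans hz⟩

theorem Pow.induction {p : Pow X → Prop} (hunit : ∀ x, p (unit x))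
    (hadd : ∀ P Q, p P → p Q → p (P + Q)) (P : Pow X) : p P := by
  obtain ⟨_, F, hF, hne, rfl⟩ := P
  change p (hat F hF hne)
  lift F to Finset X using hF
  have hne' : F.Nonempty := hne
  induction hne' using Finset.Nonempty.cons_induction with
  | singleton x => convert! hunit x; simp [unit]
  | cons x s hx hs ih =>
    have hs' : (s : Set X).Nonempty := hs
    have := hat_add_hat (Set.finite_singleton x) (Set.singleton_nonempty x) s.finite_toSet hs'
    convert! this ▸ hadd _ _ (hunit x) (ih s.finite_toSet hs')
    simp

theorem isClosed_lowerSpan {F : Set X} (hF : F.Finite) : IsClosed (lowerSpan F) := by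
  have : lowerSpan F = ⋃ a ∈ F, closure {a} := by
    ext x
    simp [lowerSpan, SpecLE]
  rw [this]
  exact hF.isClosed_biUnion fun _ _ => isClosed_closure

theorem DirConverges.mem_of_isClosed {D C : Set X} {x : X} (h : DirConverges D x)
    (hC : IsClosed C) (hDC : D ⊆ C) : x ∈ C := by
  by_contra hx
  obtain ⟨y, hy, hyC⟩ := h _ hC.isOpen_compl hx
  exact hyC (hDC hy)

/-- This makes principal ideals closed in `𝒫X`. For the lower parts: `P.lower` is closed, being
generated by a finite set, so it contains the limits of the `D i`. -/
theorem ConvC.le_of_forall_le {𝒟 : Set (Pow X)} {P Q : Pow X} (h : ConvC 𝒟 Q)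
    (hP : ∀ R ∈ 𝒟, R ≤ P) : Q ≤ P := by
  obtain ⟨n, a, D, hQ, -, hDl, hDc, hDu⟩ := h
  obtain ⟨s, -, hsl, -⟩ := P.exists_finset
  constructor
  · rw [show Q.lower = _ from congrArg Prod.fst hQ]
    rintro x ⟨_, ⟨i, rfl⟩, hx⟩
    have hai : a i ∈ P.lower := by
      refine (hDc i).mem_of_isClosed (hsl ▸ isClosed_lowerSpan s.finite_toSet) fun y hy => ?_
      obtain ⟨R, hR, hyR⟩ := Set.mem_iUnion₂.1 (hDl i hy)
      exact (hP R hR).1 hyR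
    rw [hsl] at hai ⊢
    obtain ⟨b, hb, hab⟩ := hai
    exact ⟨b, hb, hx.trans hab⟩
  · rw [show Q.upper = _ from congrArg Prod.snd hQ]
    intro x hx
    by_contra hxa
    -- If `x` is above no `a i`, the complement of `↓x` is a neighbourhood of every `a i`. The tuple
    -- chosen from it has no entry below `x`, although some member of `𝒟` forces one.
    have hmeet : ∀ i, ∃ y ∈ D i, ¬ SpecLE y x := fun i => by
      obtain ⟨y, hy, hyx⟩ := hDc i (closure {x})ᶜ isClosed_closure.isOpen_compl
        fun hi => hxa ⟨a i, ⟨i, rfl⟩, hi⟩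
      exact ⟨y, hy, hyx⟩
    choose d hd hdx using hmeet
    obtain ⟨R, hR, hRd⟩ := hDu d hd
    obtain ⟨_, ⟨i, rfl⟩, hi⟩ := hRd ((hP R hR).2 hx)
    exact hdx i hi

theorem Pow.isClosed_Iic (P : Pow X) : IsClosed (Set.Iic P) := by
  refine ⟨fun 𝒟 Q _ _ hc hQ => ?_⟩
  by_contra hempty
  exact hQ (hc.le_of_forall_le fun R hR => by_contra fun hRP => hempty ⟨R, hR, hRP⟩)

/-- The specialization order of `𝒫X` is `≤_C`. -/
theorem Pow.specLE_iff {P Q : Pow X} : SpecLE P Q ↔ P ≤ Q := by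
  refine ⟨fun h =>
    closure_minimal (t := Set.Iic Q) (Set.singleton_subset_iff.2 (le_refl Q)) Q.isClosed_Iic h,
    fun h => specializes_iff_mem_closure.1 (specializes_iff_forall_open.2 fun U hU hP => ?_)⟩
  exact IsConvOpen.isUpperSet hU h hP

theorem ConvC.dirConverges {𝒟 : Set (Pow X)} {P : Pow X} (hne : 𝒟.Nonempty)
    (hd : DirectedOn (· ≤ ·) 𝒟) (h : ConvC 𝒟 P) : DirConverges 𝒟 P :=
  fun _ hU hP => hU 𝒟 P hne hd h hP

/-- The relation `⇒_C` implies convergence in the topology it defines, so a set that passes the test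
for all convergent directed sets passes it for `⇒_C`. -/
theorem Pow.isDirectedSpace (X : Type u) [TopologicalSpace X] : IsDirectedSpace (Pow X) := by
  refine ⟨⟨fun P Q h => le_antisymm ?_ ?_⟩, fun U hU 𝒟 P hne hd hc hP => ?_⟩
  · exact Pow.specLE_iff.1 (specializes_iff_mem_closure.1 h.specializes')
  · exact Pow.specLE_iff.1 (specializes_iff_mem_closure.1 h.specializes)
  · refine hU 𝒟 P ⟨hne, fun Q hQ R hR => ?_⟩ (hc.dirConverges hne hd) hP
    obtain ⟨S, hS, h1, h2⟩ := hd Q hQ R hR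
    exact ⟨S, hS, Pow.specLE_iff.2 h1, Pow.specLE_iff.2 h2⟩

theorem Pow.isSemilatticeOp (X : Type u) [TopologicalSpace X] :
    IsSemilatticeOp fun P Q : Pow X => P + Q where
  comm := Pow.add_comm'
  assoc _ _ _ := Subtype.ext (Prod.ext (Set.union_assoc _ _ _) (Set.union_assoc _ _ _))
  idem _ := Subtype.ext (Prod.ext (Set.union_self _) (Set.union_self _))

theorem Pow.isDirectedSemilattice (X : Type u) [TopologicalSpace X] :
    IsDirectedSemilattice (Pow X) fun P Q => P + Q where
  toIsSemilatticeOp := Pow.isSemilatticeOp X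
  directedSpace := Pow.isDirectedSpace X
  sepContinuous := sepContinuous_add X

theorem continuous_unit (hX : IsDirectedSpace X) : Continuous (unit : X → Pow X) := by
  refine continuous_def.2 fun U hU => hX.2 _ fun D x hD hDx hx => ?_
  have hdir : DirectedOn (· ≤ ·) (unit '' D) := by
    rintro _ ⟨y, hy, rfl⟩ _ ⟨z, hz, rfl⟩
    obtain ⟨w, hw, h1, h2⟩ := hD.2 y hy z hz
    exact ⟨_, ⟨w, hw, rfl⟩, unit_le_unit h1, unit_le_unit h2⟩
  have hconv : ConvC (unit '' D) (unit x) := by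
    -- The one-term enumeration of `{x}`, with `D` itself as the approximating directed set.
    refine ⟨1, fun _ => x, fun _ => D, by rw [Set.range_const]; rfl, fun _ => hD,
      fun _ y hy => Set.mem_biUnion (Set.mem_image_of_mem unit hy) (subset_lowerSpan {y} rfl),
      fun _ => hDx, fun d hd => ⟨_, ⟨d 0, hd 0, rfl⟩, ?_⟩⟩
    rintro z ⟨_, rfl, hz⟩
    exact ⟨d 0, ⟨0, rfl⟩, hz⟩
  obtain ⟨_, ⟨d, hd, rfl⟩, hdU⟩ := hU (unit '' D) (unit x) (hD.1.image _) hdir hconv hx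
  exact ⟨d, hd, hdU⟩

/-! ### The universal property of `𝒫X` -/

variable {B : Type*} [TopologicalSpace B] {m : B → B → B}

/-- The homomorphism `𝒫X → B` that extends a map `f : X → B`. -/
noncomputable def Pow.lift (h : IsSemilatticeOp m) (f : X → B) (P : Pow X) : B :=
  h.sum P.exists_finset.choose P.exists_finset.choose_spec.1 f

theorem sum_specLE_sum_of_le (hB : IsDirectedSemilattice B m) {f : X → B} (hf : Continuous f)
    {ι κ : Type*} {s : Finset ι} (hs : s.Nonempty) {t : Finset κ} (ht : t.Nonempty) {a : ι → X}
    {b : κ → X} (hl : a '' s ⊆ lowerSpan (b '' t)) (hu : b '' t ⊆ upperSpan (a '' s)) :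
    SpecLE (hB.sum s hs fun i => f (a i)) (hB.sum t ht fun j => f (b j)) := by
  refine hB.sum_specLE_sum_of_egliMilner hB.sepContinuous hs ht (fun i hi => ?_) fun j hj => ?_
  · obtain ⟨_, ⟨j, hj, rfl⟩, hij⟩ := hl ⟨i, hi, rfl⟩
    exact ⟨j, hj, hij.map hf⟩
  · obtain ⟨_, ⟨i, hi, rfl⟩, hij⟩ := hu ⟨j, hj, rfl⟩
    exact ⟨i, hi, hij.map hf⟩

theorem subset_upperSpan (F : Set X) : F ⊆ upperSpan F :=
  fun x hx => ⟨x, hx, SpecLE.refl x⟩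

/-- `Pow.lift` uses a chosen representative. Any other one is Egli-Milner equivalent to it, so the
two sums lie below each other and agree by `T₀`. -/
theorem Pow.lift_eq_sum (hB : IsDirectedSemilattice B m) {f : X → B} (hf : Continuous f)
    {P : Pow X} {ι : Type*} {s : Finset ι} (hs : s.Nonempty) {a : ι → X}
    (hl : P.lower = lowerSpan (a '' s)) (hu : P.upper = upperSpan (a '' s)) :
    Pow.lift hB.toIsSemilatticeOp f P = hB.sum s hs fun i => f (a i) := by
  have := hB.directedSpace.1
  obtain ⟨ht, htl, htu⟩ := P.exists_finset.choose_spec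
  set t := P.exists_finset.choose
  have htid : (fun x : X => x) '' (t : Set X) = t := Set.image_id' _
  refine SpecLE.antisymm (sum_specLE_sum_of_le hB hf ht hs (a := fun x => x) ?_ ?_)
    (sum_specLE_sum_of_le hB hf hs ht (b := fun x => x) ?_ ?_) <;> rw [htid]
  · rw [← hl, htl]; exact subset_lowerSpan _
  · rw [← htu, hu]; exact subset_upperSpan _
  · rw [← htl, hl]; exact subset_lowerSpan _
  · rw [← hu, htu]; exact subset_upperSpan _

theorem Pow.lift_unit (hB : IsDirectedSemilattice B m) {f : X → B} (hf : Continuous f) (x : X) :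
    Pow.lift hB.toIsSemilatticeOp f (unit x) = f x :=
  Pow.lift_eq_sum hB hf (Finset.singleton_nonempty x) (a := fun x => x)
    (by simp [unit, hat, Pow.lower]) (by simp [unit, hat, Pow.upper])

theorem Pow.lift_add (hB : IsDirectedSemilattice B m) {f : X → B} (hf : Continuous f)
    (P Q : Pow X) : Pow.lift hB.toIsSemilatticeOp f (P + Q) =
      m (Pow.lift hB.toIsSemilatticeOp f P) (Pow.lift hB.toIsSemilatticeOp f Q) := by
  classical
  obtain ⟨s, hs, hsl, hsu⟩ := P.exists_finset
  obtain ⟨t, ht, htl, htu⟩ := Q.exists_finset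
  rw [Pow.lift_eq_sum (P := P) hB hf hs (a := fun x => x) (by simpa using hsl) (by simpa using hsu),
    Pow.lift_eq_sum (P := Q) hB hf ht (a := fun x => x) (by simpa using htl) (by simpa using htu),
    ← hB.sum_union hs ht]
  refine Pow.lift_eq_sum hB hf hs.inl (a := fun x => x) ?_ ?_ <;>
    rw [Set.image_id', Finset.coe_union]
  · rw [lowerSpan_union, ← hsl, ← htl]; rfl
  · rw [upperSpan_union, ← hsu, ← htu]; rfl

/-- Directedness absorbs finitely many conditions. Staying above `R` preserves the inclusion of
upper sets already secured for `R`. -/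
theorem Pow.exists_ge_of_finite {𝒟 : Set (Pow X)} (hd : DirectedOn (· ≤ ·) 𝒟) {R : Pow X}
    (hR : R ∈ 𝒟) {n : ℕ} {d : Fin n → X} (hdl : ∀ i, d i ∈ ⋃ Q ∈ 𝒟, Q.lower) :
    ∃ Q ∈ 𝒟, R ≤ Q ∧ ∀ i, d i ∈ Q.lower := by
  have key : ∀ s : Finset (Fin n), ∃ Q ∈ 𝒟, R ≤ Q ∧ ∀ i ∈ s, d i ∈ Q.lower := by
    intro s
    induction s using Finset.induction_on with
    | empty => exact ⟨R, hR, le_rfl, by simp⟩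
    | insert i s _ ih =>
      obtain ⟨Q, hQ, hRQ, hQs⟩ := ih
      obtain ⟨S, hS, hiS⟩ := Set.mem_iUnion₂.1 (hdl i)
      obtain ⟨T, hT, hQT, hST⟩ := hd Q hQ S hS
      refine ⟨T, hT, hRQ.trans hQT, fun j hj => ?_⟩
      obtain rfl | hj := Finset.mem_insert.1 hj
      exacts [hST.1 hiS, hQT.1 (hQs j hj)]
  obtain ⟨Q, hQ, hRQ, hQd⟩ := key Finset.univ
  exact ⟨Q, hQ, hRQ, fun i => hQd i (Finset.mem_univ i)⟩

theorem Pow.continuous_lift (hB : IsDirectedSemilattice B m) {f : X → B} (hf : Continuous f) :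
    Continuous (Pow.lift hB.toIsSemilatticeOp f : Pow X → B) := by
  refine continuous_def.2 fun U hU 𝒟 P _ hd ⟨n, a, D, hP, _, hDl, hDc, hDu⟩ hPU => ?_
  have hPl : P.lower = lowerSpan (Set.range a) := congrArg Prod.fst hP
  have hPu : P.upper = upperSpan (Set.range a) := congrArg Prod.snd hP
  -- `ConvC` formally admits `n = 0`; this is excluded because `P.upper` is nonempty.
  have hn : (Finset.univ : Finset (Fin n)).Nonempty := by
    obtain ⟨x, hx⟩ := P.upper_nonempty
    rw [hPu] at hx
    obtain ⟨_, ⟨i, rfl⟩, _⟩ := hx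
    exact ⟨i, Finset.mem_univ i⟩
  rw [Set.mem_preimage, Pow.lift_eq_sum hB hf hn (by simpa using hPl) (by simpa using hPu)] at hPU
  obtain ⟨d, hdD, hdU⟩ := hB.exists_sum_mem hB.sepContinuous hf hn hDc hU hPU
  obtain ⟨R, hR, hRd⟩ := hDu d hdD
  -- `R` gives the upper half of the Egli-Milner comparison of `d` with a member of `𝒟`; enlarging
  -- it to `Q` adds the lower half. Open sets are upper sets, so the value at `Q` lies in `U`.
  obtain ⟨Q, hQ, hRQ, hQd⟩ := Pow.exists_ge_of_finite hd hR fun i => hDl i (hdD i)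
  refine ⟨Q, hQ, ?_⟩
  obtain ⟨t, ht, htl, htu⟩ := Q.exists_finset
  rw [Set.mem_preimage, Pow.lift_eq_sum hB hf ht (a := fun x => x) (by simpa using htl)
    (by simpa using htu)]
  refine (sum_specLE_sum_of_le hB hf hn ht (b := fun x => x) ?_ ?_).mem_open hU hdU
  · rw [Set.image_id', ← htl]
    rintro _ ⟨i, -, rfl⟩
    exact hQd i
  · rw [Set.image_id', Finset.coe_univ, Set.image_univ]
    refine (subset_upperSpan _).trans ?_
    rw [← htu]
    exact hRQ.2.trans hRd

theorem Pow.hom_ext {B : Type*} {m : B → B → B} {g h : Pow X → B}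
    (hg : ∀ P Q, g (P + Q) = m (g P) (g Q)) (hh : ∀ P Q, h (P + Q) = m (h P) (h Q))
    (hgh : ∀ x, g (unit x) = h (unit x)) : g = h :=
  funext <| Pow.induction hgh fun P Q hP hQ => by rw [hg, hh, hP, hQ]

theorem isDirectedConvexPowerspace_pow (hX : IsDirectedSpace X) :
    IsDirectedConvexPowerspace.{u, u, v} X (Pow X) (fun P Q => P + Q) unit where
  semilattice := Pow.isDirectedSemilattice X
  continuous := continuous_unit hX
  universal B _ mB hB f hf := by
    refine ⟨Pow.lift hB.toIsSemilatticeOp f, ⟨Pow.continuous_lift hB hf, Pow.lift_add hB hf,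
      Pow.lift_unit hB hf⟩, fun g ⟨_, hg, hgf⟩ => ?_⟩
    exact Pow.hom_ext hg (Pow.lift_add hB hf) fun x => by rw [hgf, Pow.lift_unit hB hf]

end Pow

/-! ### The D-completion -/

section DCompletion

variable {Y : Type u} [TopologicalSpace Y]

theorem Gam.exists_isLUB {d : Set (Gam Y)} (hne : d.Nonempty) : ∃ A : Gam Y, IsLUB d A := by
  obtain ⟨B, hB⟩ := hne
  have hsub : ∀ C ∈ d, (C.1 : Set Y) ⊆ closure (⋃ C ∈ d, (C.1 : Set Y)) := fun C hC =>
    (Set.subset_biUnion_of_mem (u := fun C : Gam Y => (C.1 : Set Y)) hC).trans subset_closure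
  refine ⟨⟨TopologicalSpace.Closeds.closure (⋃ C ∈ d, (C.1 : Set Y)), B.2.mono (hsub B hB)⟩,
    fun C hC => hsub C hC, fun C hC => ?_⟩
  exact closure_minimal (Set.iUnion₂_subset fun E hE => hC hE) C.1.isClosed

theorem dirSupClosed_dClosure {P : Type*} [PartialOrder P] (S : Set P) :
    DirSupClosed (dClosure S) :=
  DirSupClosed.sInter fun _ hT => hT.2

/-- The supremum is taken in `Γ(Y)`, which is stronger than a supremum in the subtype and allows it
to be described as a closure of a union. -/
theorem DCompletion.exists_isLUB {d : Set (DCompletion Y)} (hne : d.Nonempty)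
    (hd : DirectedOn (· ≤ ·) d) :
    ∃ A : DCompletion Y, IsLUB (Subtype.val '' d) A.1 := by
  obtain ⟨A, hA⟩ := Gam.exists_isLUB (hne.image Subtype.val)
  refine ⟨⟨A, dirSupClosed_dClosure _ ?_ (hne.image _) ?_ hA⟩, hA⟩
  · rintro _ ⟨C, _, rfl⟩
    exact C.2
  · rintro _ ⟨C, hC, rfl⟩ _ ⟨E, hE, rfl⟩
    obtain ⟨F, hF, h1, h2⟩ := hd C hC E hE
    exact ⟨_, ⟨F, hF, rfl⟩, h1, h2⟩

theorem isLUB_of_isLUB_val {P : Type*} [PartialOrder P] {p : P → Prop} {d : Set {x // p x}}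
    {A : {x // p x}} (h : IsLUB (Subtype.val '' d) A.1) : IsLUB d A := by
  refine ⟨fun C hC => h.1 ⟨C, hC, rfl⟩, fun E hE => h.2 ?_⟩
  rintro _ ⟨C, hC, rfl⟩
  exact hE hC

theorem DCompletion.isLUB_val {d : Set (DCompletion Y)} (hne : d.Nonempty)
    (hd : DirectedOn (· ≤ ·) d) {A : DCompletion Y} (hA : IsLUB d A) :
    IsLUB (Subtype.val '' d) A.1 := by
  obtain ⟨C, hC⟩ := DCompletion.exists_isLUB hne hd
  rwa [hA.unique (isLUB_of_isLUB_val hC)]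

theorem DCompletion.isDcpo (Y : Type u) [TopologicalSpace Y] : IsDcpo (DCompletion Y) :=
  fun _ hne hd => (DCompletion.exists_isLUB hne hd).imp fun _ => isLUB_of_isLUB_val

theorem DCompletion.subset_closure_of_isLUB {d : Set (DCompletion Y)} (hne : d.Nonempty)
    (hd : DirectedOn (· ≤ ·) d) {A : DCompletion Y} (hA : IsLUB d A) :
    (A.1.1 : Set Y) ⊆ closure (⋃ C ∈ d, (C.1.1 : Set Y)) := by
  have := ConvexPowerdomain.subset_closure_of_isLUB (hne.image _) (isLUB_val hne hd hA)
  rwa [Set.biUnion_image] at this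

theorem DCompletion.induction {p : DCompletion Y → Prop} (heta : ∀ y, p (eta y))
    (hsup : ∀ (d : Set (DCompletion Y)) (A : DCompletion Y), d.Nonempty →
      DirectedOn (· ≤ ·) d → IsLUB d A → (∀ C ∈ d, p C) → p A) (A : DCompletion Y) : p A := by
  -- Minimality of the d-closure concerns subsets of `Γ(Y)`, so the predicate is transported there
  -- together with the membership proof.
  have key := Set.mem_sInter.1 A.2 {A | ∃ hA, p ⟨A, hA⟩} ⟨?_, ?_⟩
  · exact key.2
  · rintro _ ⟨y, rfl⟩
    exact ⟨(eta y).2, heta y⟩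
  · intro d hd hne hdir E hE
    have hEc := dirSupClosed_dClosure _ (fun C hC => (hd hC).1) hne hdir hE
    have himg : Subtype.val '' (Subtype.val ⁻¹' d : Set (DCompletion Y)) = d := by
      rw [Subtype.image_preimage_coe]
      exact Set.inter_eq_right.2 fun C hC => (hd hC).1
    refine ⟨hEc, hsup (Subtype.val ⁻¹' d) _ ?_ ?_ (isLUB_of_isLUB_val (himg.symm ▸ hE)) ?_⟩
    · obtain ⟨C, hC⟩ := hne
      exact ⟨⟨C, (hd hC).1⟩, hC⟩
    · intro C hC F hF
      obtain ⟨G, hG, h1, h2⟩ := hdir _ hC _ hF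
      exact ⟨⟨G, (hd hG).1⟩, hG, h1, h2⟩
    · exact fun C hC => (hd hC).2

theorem DCompletion.hom_ext {B : Type*} [PartialOrder B] {f g : DCompletion Y → B}
    (hf : ScottContinuous f) (hg : ScottContinuous g) (h : ∀ y, f (eta y) = g (eta y)) :
    f = g := by
  refine funext (DCompletion.induction h fun d A hne hd hA hdA => (hf hne hd hA).unique ?_)
  rw [Set.image_congr hdA]
  exact hg hne hd hA

/-! ### Semilattice operations on the D-completion -/

variable {m : Y → Y → Y}

theorem extend_eta (hm : SepContinuous m) (x y : Y) :
    extend m hm (eta x) (eta y) = eta (m x y) :=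
  Subtype.ext (gam_princ hm x y)

theorem extend_comm (h : IsSemilatticeOp m) (hm : SepContinuous m) (A B : DCompletion Y) :
    extend m hm A B = extend m hm B A := by
  have hsymm : (fun a b => m b a) = m := funext fun a => funext fun b => h.comm b a
  refine Subtype.ext ((gam_swap m A.1 B.1).trans ?_)
  rw [hsymm, extend]

theorem scottContinuous_extend_left (hm : SepContinuous m) (B : DCompletion Y) :
    ScottContinuous fun A => extend m hm A B := by
  intro d hne hd A hA
  apply isLUB_of_isLUB_val
  have := gam_isLUB hm.1 (hne.image _) (DCompletion.isLUB_val hne hd hA) B.1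
  rw [Set.image_image] at this ⊢
  exact this

theorem scottContinuous_extend_right (h : IsSemilatticeOp m) (hm : SepContinuous m)
    (A : DCompletion Y) : ScottContinuous fun B => extend m hm A B := by
  simp only [extend_comm h hm A]
  exact scottContinuous_extend_left hm A

/-- Separate Scott continuity implies joint Scott continuity, so separate continuity on `Y` is
enough here. -/
theorem scottContinuous_extend (h : IsSemilatticeOp m) (hm : SepContinuous m) :
    ScottContinuous fun p : DCompletion Y × DCompletion Y => extend m hm p.1 p.2 :=
  ScottContinuous.fromProd (scottContinuous_extend_right h hm) (scottContinuous_extend_left hm)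

theorem extend_idem (h : IsSemilatticeOp m) (hm : SepContinuous m) (A : DCompletion Y) :
    extend m hm A A = A :=
  congrFun (DCompletion.hom_ext (f := fun A => extend m hm A A) (g := id)
    ((ScottContinuous.id.prodMk ScottContinuous.id).comp (scottContinuous_extend h hm))
    ScottContinuous.id fun y => by rw [extend_eta, h.idem, id]) A

/-- The law holds on `η(Y)` and is extended one variable at a time, the others being held fixed. -/
theorem extend_assoc (h : IsSemilatticeOp m) (hm : SepContinuous m) (A B C : DCompletion Y) :
    extend m hm (extend m hm A B) C = extend m hm A (extend m hm B C) := by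
  have hl := scottContinuous_extend_left hm
  have hr := scottContinuous_extend_right h hm
  have h1 : ∀ x y C, extend m hm (extend m hm (eta x) (eta y)) C =
      extend m hm (eta x) (extend m hm (eta y) C) := fun x y C =>
    congrFun (DCompletion.hom_ext (hr _) ((hr (eta y)).comp (hr (eta x)))
      fun z => by simp only [Function.comp_apply, extend_eta, h.assoc]) C
  have h2 : ∀ x B C, extend m hm (extend m hm (eta x) B) C =
      extend m hm (eta x) (extend m hm B C) := fun x B C =>
    congrFun (DCompletion.hom_ext ((hr (eta x)).comp (hl C)) ((hl C).comp (hr (eta x)))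
      fun y => h1 x y C) B
  exact congrFun (DCompletion.hom_ext ((hl B).comp (hl C)) (hl (extend m hm B C))
    fun x => h2 x B C) A

theorem isDcpoSemilattice_extend (h : IsSemilatticeOp m) (hm : SepContinuous m) :
    IsDcpoSemilattice (DCompletion Y) (extend m hm) where
  comm := extend_comm h hm
  assoc := extend_assoc h hm
  idem := extend_idem h hm
  dcpo := DCompletion.isDcpo Y
  scottContinuous := scottContinuous_extend h hm

/-! ### The universal property of the D-completion -/

variable {B : Type*} [PartialOrder B] {g : Y → B}

theorem isClosed_preimage_Iic (hg : Continuous fun y => Topology.WithScott.toScott (g y)) (b : B) :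
    IsClosed (g ⁻¹' Set.Iic b) :=
  (isClosed_Iic (a := Topology.WithScott.toScott b)).preimage hg

theorem isLUB_image_princ (hg : Continuous fun y => Topology.WithScott.toScott (g y)) (y : Y) :
    IsLUB (g '' ((eta y).1.1 : Set Y)) (g y) := by
  refine ⟨?_, fun b hb => hb ⟨y, subset_closure rfl, rfl⟩⟩
  rintro _ ⟨x, hx, rfl⟩
  exact closure_minimal (t := g ⁻¹' Set.Iic (g y)) (Set.singleton_subset_iff.2 le_rfl)
    (isClosed_preimage_Iic hg (g y)) hx

/-- The two sets have the same upper bounds: `g⁻¹(↓c)` is closed, so it contains `A` as soon as it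
contains every `C ∈ d`. Existence of `sup g(A)` and Scott continuity of `A ↦ sup g(A)` both come
from this. -/
theorem isLUB_image_of_isLUB (hg : Continuous fun y => Topology.WithScott.toScott (g y))
    {d : Set (DCompletion Y)} (hne : d.Nonempty) (hd : DirectedOn (· ≤ ·) d) {A : DCompletion Y}
    (hA : IsLUB d A) {G : DCompletion Y → B}
    (hG : ∀ C ∈ d, IsLUB (g '' (C.1.1 : Set Y)) (G C)) {b : B} :
    IsLUB (g '' (A.1.1 : Set Y)) b ↔ IsLUB (G '' d) b := by
  have : upperBounds (g '' (A.1.1 : Set Y)) = upperBounds (G '' d) := by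
    ext c
    constructor
    · rintro hc _ ⟨C, hC, rfl⟩
      refine (hG C hC).2 ?_
      rintro _ ⟨y, hy, rfl⟩
      exact hc ⟨y, hA.1 hC hy, rfl⟩
    · rintro hc _ ⟨y, hy, rfl⟩
      refine closure_minimal (Set.iUnion₂_subset fun C hC x hx => ?_)
        (isClosed_preimage_Iic hg c) (DCompletion.subset_closure_of_isLUB hne hd hA hy)
      exact ((hG C hC).1 ⟨x, hx, rfl⟩).trans (hc ⟨C, hC, rfl⟩)
  rw [IsLUB, IsLUB, this]

theorem directedOn_image_of_isLUB {d : Set (DCompletion Y)} (hd : DirectedOn (· ≤ ·) d)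
    {G : DCompletion Y → B} (hG : ∀ C ∈ d, IsLUB (g '' (C.1.1 : Set Y)) (G C)) :
    DirectedOn (· ≤ ·) (G '' d) := by
  rintro _ ⟨C, hC, rfl⟩ _ ⟨E, hE, rfl⟩
  obtain ⟨F, hF, h1, h2⟩ := hd C hC E hE
  exact ⟨_, ⟨F, hF, rfl⟩, (hG C hC).mono (hG F hF) (Set.image_mono h1),
    (hG E hE).mono (hG F hF) (Set.image_mono h2)⟩

/-- The set `g(A)` need not be directed, so the supremum is built by induction over the
D-completion: `g y` for `↓y`, then directed suprema of values already obtained. -/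
theorem exists_isLUB_image (hB : IsDcpo B)
    (hg : Continuous fun y => Topology.WithScott.toScott (g y)) (A : DCompletion Y) :
    ∃ b, IsLUB (g '' (A.1.1 : Set Y)) b := by
  induction A using DCompletion.induction with
  | heta y => exact ⟨g y, isLUB_image_princ hg y⟩
  | hsup d A hne hd hA ih =>
    have : Nonempty B := hne.elim fun C hC => (ih C hC).nonempty
    choose! G hG using ih
    obtain ⟨b, hb⟩ := hB _ (hne.image G) (directedOn_image_of_isLUB hd hG)
    exact ⟨b, (isLUB_image_of_isLUB hg hne hd hA hG).2 hb⟩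

theorem DCompletion.exists_lift (hB : IsDcpo B)
    (hg : Continuous fun y => Topology.WithScott.toScott (g y)) :
    ∃ G : DCompletion Y → B, ScottContinuous G ∧ ∀ y, G (eta y) = g y := by
  choose G hG using exists_isLUB_image hB hg
  refine ⟨G, fun d hne hd A hA => ?_, fun y => (hG _).unique (isLUB_image_princ hg y)⟩
  exact (isLUB_image_of_isLUB hg hne hd hA fun C _ => hG C).1 (hG A)

theorem hom_of_hom_eta (h : IsSemilatticeOp m) (hm : SepContinuous m) {mB : B → B → B}
    (hB : IsDcpoSemilattice B mB) {G : DCompletion Y → B} (hG : ScottContinuous G)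
    (hGm : ∀ x y, G (eta (m x y)) = mB (G (eta x)) (G (eta y))) (A C : DCompletion Y) :
    G (extend m hm A C) = mB (G A) (G C) := by
  have hBl : ∀ b, ScottContinuous fun a => mB a b := fun b =>
    (ScottContinuous.id.prodMk (ScottContinuous.const b)).comp hB.scottContinuous
  have hBr : ∀ a, ScottContinuous fun b => mB a b := fun a => by
    simpa only [hB.comm a] using hBl a
  have h1 : ∀ x C, G (extend m hm (eta x) C) = mB (G (eta x)) (G C) := fun x C =>
    congrFun (DCompletion.hom_ext ((scottContinuous_extend_right h hm (eta x)).comp hG)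
      (hG.comp (hBr (G (eta x))))
      fun y => by simp only [Function.comp_apply, extend_eta, hGm]) C
  exact congrFun (DCompletion.hom_ext ((scottContinuous_extend_left hm C).comp hG)
    (hG.comp (hBl (G C))) fun x => h1 x C) A

end DCompletion

/-! ### Scott spaces of dcpos -/

section Scott

open Topology

variable {L : Type u} [PartialOrder L]

theorem WithScott.specLE_iff {x y : WithScott L} : SpecLE x y ↔ x ≤ y := by
  rw [SpecLE, IsScott.closure_singleton, Set.mem_Iic]

theorem continuous_withScott_iff {M : Type*} [PartialOrder M] {f : L → M} :
    (Continuous fun x : WithScott L => WithScott.toScott (f (WithScott.ofScott x))) ↔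
      ScottContinuous f := by
  rw [← scottContinuousOn_univ]
  exact (IsScott.scottContinuousOn_iff_continuous (α := WithScott L) (β := WithScott M)
    (D := Set.univ) fun _ _ _ => trivial).symm

theorem isDirectedSpace_withScott (L : Type u) [PartialOrder L] :
    IsDirectedSpace (WithScott L) := by
  refine ⟨?_, fun U hU => ?_⟩
  · rw [t0Space_iff_inseparable]
    intro x y h
    exact le_antisymm (α := L)
      (WithScott.specLE_iff.1 (specializes_iff_mem_closure.1 h.specializes'))
      (WithScott.specLE_iff.1 (specializes_iff_mem_closure.1 h.specializes))
  · rw [IsScott.isOpen_iff_isUpperSet_and_dirSupInaccOn (D := Set.univ)]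
    refine ⟨fun x y hxy hx => ?_, fun d _ hne hd x hx hxU => ?_⟩
    -- For `x ≤ y` the directed set `{y}` converges to `x`, which makes `U` an upper set.
    · obtain ⟨_, rfl, hyU⟩ := hU {y} x (specDirected_singleton y)
        (fun V hV hxV => ⟨y, rfl, (WithScott.specLE_iff.2 hxy).mem_open hV hxV⟩) hx
      exact hyU
    · refine hU d x ⟨hne, hd.mono fun _ _ h => WithScott.specLE_iff.2 h⟩ (fun V hV hxV => ?_) hxU
      exact (IsScott.isOpen_iff_isUpperSet_and_dirSupInaccOn (D := Set.univ).1 hV).2 trivial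
        hne hd hx hxV

theorem isDirectedSemilattice_withScott {m : L → L → L} (h : IsDcpoSemilattice L m) :
    IsDirectedSemilattice (WithScott L) fun a b =>
      WithScott.toScott (m (WithScott.ofScott a) (WithScott.ofScott b)) where
  comm := h.comm
  assoc := h.assoc
  idem := h.idem
  directedSpace := isDirectedSpace_withScott L
  sepContinuous := by
    have hl : ∀ b, ScottContinuous fun a => m a b := fun b =>
      (ScottContinuous.id.prodMk (ScottContinuous.const b)).comp h.scottContinuous
    have hr : ∀ a, ScottContinuous fun b => m a b := fun a => by
      simpa only [h.comm a] using hl a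
    exact ⟨fun b => continuous_withScott_iff.2 (hl b), fun a => continuous_withScott_iff.2 (hr a)⟩

/-- `η(y) ≤ C` means `y ∈ C`. So an upper bound `C` of the image of `d` yields a Scott-closed set
`i⁻¹(C)` containing `d`, hence also its supremum. -/
theorem scottContinuous_eta_comp {Y : Type*} [TopologicalSpace Y] {i : WithScott L → Y}
    (hi : Continuous i) : ScottContinuous fun x : L => eta (i (WithScott.toScott x)) := by
  intro d hne hd x hx
  have key : ∀ C : DCompletion Y, ∀ y : Y, eta y ≤ C ↔ y ∈ C.1.1 := fun C y =>
    ⟨fun h => h (subset_closure rfl),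
      fun h => closure_minimal (Set.singleton_subset_iff.2 h) C.1.1.isClosed⟩
  constructor
  · rintro _ ⟨y, hy, rfl⟩
    exact (key _ _).2 ((WithScott.specLE_iff.2 (hx.1 hy)).map hi)
  · intro C hC
    rw [key]
    refine IsScott.dirSupClosed_of_isClosed (C.1.1.isClosed.preimage hi) (d := d)
      (fun y hy => ?_) hne hd hx
    exact (key _ _).1 (hC ⟨y, hy, rfl⟩)

theorem isConvexPowerdomain_dCompletion (L : Type u) [PartialOrder L] :
    IsConvexPowerdomain.{u, u, v} L (DCompletion (ScottPow L)) plusD dUnit where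
  semilattice := isDcpoSemilattice_extend (Pow.isSemilatticeOp _) (sepContinuous_add _)
  scottContinuous := scottContinuous_eta_comp (continuous_unit (isDirectedSpace_withScott L))
  universal B _ mB hB f hf := by
    obtain ⟨g, ⟨hgc, hgm, hgf⟩, -⟩ :=
      (isDirectedConvexPowerspace_pow (isDirectedSpace_withScott L)).universal (WithScott B) _
        (isDirectedSemilattice_withScott hB) _ (continuous_withScott_iff.2 hf)
    obtain ⟨G, hG, hGg⟩ := DCompletion.exists_lift (g := fun P => WithScott.ofScott (g P))
      hB.dcpo hgc
    have hGm := hom_of_hom_eta (Pow.isSemilatticeOp _) (sepContinuous_add _) hB hG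
      fun P Q => by rw [hGg, hGg, hGg, hgm]; rfl
    refine ⟨G, ⟨hG, hGm, fun x => (hGg _).trans (hgf _)⟩, fun H ⟨hH, hHm, hHf⟩ => ?_⟩
    -- Uniqueness drops from the completion to `𝒫L` by Scott continuity, then from `𝒫L` to
    -- singletons by algebra alone.
    refine DCompletion.hom_ext hH hG fun P => ?_
    refine congrFun (Pow.hom_ext (m := mB) (g := fun P => H (eta P)) (h := fun P => G (eta P))
      (fun P Q => ?_) (fun P Q => ?_) fun x => ?_) P
    · rw [← hHm, plusD, extend_eta]
    · rw [← hGm, extend_eta]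
    · exact (hHf _).trans ((hGg _).trans (hgf _)).symm

/-- Convex powerdomains of `L` are unique up to a unique isomorphism. -/
theorem IsConvexPowerdomain.exists_orderIso {A Q : Type u} [PartialOrder A] [PartialOrder Q]
    {mA : A → A → A} {mQ : Q → Q → Q} {i : L → A} {j : L → Q}
    (hA : IsConvexPowerdomain.{u, u, u} L A mA i) (hQ : IsConvexPowerdomain.{u, u, u} L Q mQ j) :
    ∃ e : A ≃o Q, (∀ a b, e (mA a b) = mQ (e a) (e b)) ∧ ∀ x, e (i x) = j x := by
  obtain ⟨f, ⟨hf, hfm, hfi⟩, -⟩ := hA.universal Q mQ hQ.semilattice j hQ.scottContinuous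
  obtain ⟨g, ⟨hg, hgm, hgj⟩, -⟩ := hQ.universal A mA hA.semilattice i hA.scottContinuous
  have hgf : g ∘ f = id :=
    (hA.universal A mA hA.semilattice i hA.scottContinuous).unique
      ⟨hf.comp hg, fun a b => by simp [hfm, hgm], fun x => by simp [hfi, hgj]⟩
      ⟨ScottContinuous.id, fun _ _ => rfl, fun _ => rfl⟩
  have hfg : f ∘ g = id :=
    (hQ.universal Q mQ hQ.semilattice j hQ.scottContinuous).unique
      ⟨hg.comp hf, fun a b => by simp [hfm, hgm], fun x => by simp [hfi, hgj]⟩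
      ⟨ScottContinuous.id, fun _ _ => rfl, fun _ => rfl⟩
  exact ⟨Equiv.toOrderIso ⟨f, g, congrFun hgf, congrFun hfg⟩ hf.monotone hg.monotone, hfm, hfi⟩

end Scott

end ConvexPowerdomain

theorem mainTheorem5 {L : Type u} [PartialOrder L] (hL : ConvexPowerdomain.IsDcpo L) :
    ConvexPowerdomain.IsDirectedConvexPowerspace.{u, u, v} (Topology.WithScott L)
        (ConvexPowerdomain.ScottPow L) (fun P Q => P + Q) ConvexPowerdomain.unit ∧
      ConvexPowerdomain.IsConvexPowerdomain.{u, u, v} L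
        (ConvexPowerdomain.DCompletion (ConvexPowerdomain.ScottPow L))
        ConvexPowerdomain.plusD ConvexPowerdomain.dUnit ∧
      ∀ (Q : Type u) [PartialOrder Q] (m : Q → Q → Q) (j : L → Q),
        ConvexPowerdomain.IsConvexPowerdomain.{u, u, u} L Q m j →
          ∃ e : ConvexPowerdomain.DCompletion (ConvexPowerdomain.ScottPow L) ≃o Q,
            (∀ A B, e (ConvexPowerdomain.plusD A B) = m (e A) (e B)) ∧
              ∀ x, e (ConvexPowerdomain.dUnit x) = j x := by
  exact ⟨ConvexPowerdomain.isDirectedConvexPowerspace_pow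
      (ConvexPowerdomain.isDirectedSpace_withScott L),
    ConvexPowerdomain.isConvexPowerdomain_dCompletion L,
    fun _ _ _ _ hQ => (ConvexPowerdomain.isConvexPowerdomain_dCompletion L).exists_orderIso hQ⟩
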